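/- Consider two-variable first-order logic with modulo counting quantifiers over finite, unranked, ordered trees whose nodes are labelled by arbitrary sets of unary predicates. Formulas use only the variables $x,y$, equality, unary predicates, and the binary symbols $\downarrow$ (child), $\to$ (right sibling) and their transitive closures $\downarrow^+$, $\to^+$. The quantifier $\exists^{\bowtie k,l}y\,\psi(x,y)$, with $\bowtie\,\in\{\le,=,\ge\}$, $l\ge 1$ and $0\le k<l$, is true at a node $a$ if the remainder modulo $l$ of the number of nodes $b$ with $\psi[a,b]$ is in relation $\bowtie$ to $k$. Let $\varphi$ be a formula of this logic in normal form, that is, $$\varphi=\forall x\forall y\,\chi(x,y)\;\wedge\;\bigwedge_{i=1}^{n}\forall x\exists y\,\chi_i(x,y)\;\wedge\;\bigwedge_{j=1}^{m}\forall x\,\exists^{\bowtie_j k_j,l_j}y\,\psi_j(x,y),$$ where $n,m\ge 1$, $\bowtie_j\in\{\le,\ge\}$, $l_j\ge1$, $0\le k_j<l_j$, and $\chi,\chi_i,\psi_j$ are quantifier-free. Put $$f(\varphi)=(2\,l_1l_2\cdots l_m)^{|\Theta|\,|\boldsymbol\alpha|},$$ where $\Theta$ is the set of the ten order formulas describing the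 possible relative positions of two nodes of a tree ($x\downarrow y$; $x\downarrow^+y\wedge\neg\, x\downarrow y$; $x\to y$; $x\to^+y\wedge\neg\, x\to y$; the converses of these four; $x=y$; none of these), and $\boldsymbol\alpha$ is the set of atomic $1$-types over the signature of $\varphi$, so that $|\boldsymbol\alpha|=2^{p}$ with $p$ the number of unary predicates occurring in $\varphi$. Thus $f(\varphi)$ is the number of functions $\Theta\to\boldsymbol\alpha\to\{0,1\}\times\mathbb Z_{l_1}\times\cdots\times\mathbb Z_{l_m}$. **Theorem (small model theorem).** The number $f(\varphi)$ is at most doubly exponential in the length $|\varphi|$ of $\varphi$ (numbers in quantifiers being written in binary): there is a constant $c$ with $f(\varphi)\le 2^{2^{c|\varphi|}}$ for all $\varphi$ in normal form. If $\varphi$ is satisfied in some finite tree, then it has a finite tree model in which every downward path (each node a child of the previous one) has at most $f(\varphi)$ nodes and every node has at most $f(\varphi)$ children. -/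

import Mathlib

namespace FO2Mod

/-! ### Syntax of two-variable logic with modulo counting quantifiers -/

/-- The two variables of the logic. -/
inductive Var
  | x
  | y
  deriving DecidableEq

/-- The navigational binary symbols: child, descendant (transitive closure of child),
right sibling, following sibling (transitive closure of right sibling). -/
inductive Nav
  | child
  | desc
  | rightSib
  | followSib

/-- The comparison symbols allowed in modulo counting quantifiers. -/
inductive Cmp
  | le
  | eq
  | ge
  deriving DecidableEq

/-- The comparison of natural numbers denoted by a comparison symbol. -/
def Cmp.holds : Cmp → ℕ → ℕ → Prop
  | .le, a, b => a ≤ b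
  | .eq, a, b => a = b
  | .ge, a, b => b ≤ a

/-- Formulas with the variables `x`, `y`, unary symbols from `P`, the four navigational symbols
and equality. The formula `exMod c l k v φ` is the modulo counting quantifier saying that the
number of values of `v` satisfying `φ`, reduced modulo `l`, is in the relation `c` to `k`
(having `k : Fin l` forces `l` to be positive and `k < l`). -/
inductive Formula (P : Type*)
  | unary (p : P) (v : Var)
  | nav (r : Nav) (v w : Var)
  | equal (v w : Var)
  | neg (φ : Formula P)
  | and (φ ψ : Formula P)
  | or (φ ψ : Formula P)
  | imp (φ ψ : Formula P)
  | all (v : Var) (φ : Formula P)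
  | ex (v : Var) (φ : Formula P)
  | exMod (c : Cmp) (l : ℕ) (k : Fin l) (v : Var) (φ : Formula P)

namespace Formula

variable {P : Type*}

/-- Quantifier-free formulas. -/
def QuantifierFree : Formula P → Prop
  | unary _ _ => True
  | nav _ _ _ => True
  | equal _ _ => True
  | neg φ => φ.QuantifierFree
  | and φ ψ => φ.QuantifierFree ∧ ψ.QuantifierFree
  | or φ ψ => φ.QuantifierFree ∧ ψ.QuantifierFree
  | imp φ ψ => φ.QuantifierFree ∧ ψ.QuantifierFree
  | all _ _ => False
  | ex _ _ => False
  | exMod _ _ _ _ _ => False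

/-- The unary symbols occurring in a formula. -/
def symbols : Formula P → Set P
  | unary p _ => {p}
  | nav _ _ _ => ∅
  | equal _ _ => ∅
  | neg φ => φ.symbols
  | and φ ψ => φ.symbols ∪ ψ.symbols
  | or φ ψ => φ.symbols ∪ ψ.symbols
  | imp φ ψ => φ.symbols ∪ ψ.symbols
  | all _ φ => φ.symbols
  | ex _ φ => φ.symbols
  | exMod _ _ _ _ φ => φ.symbols

/-- The length of a formula: the number of its symbols (parentheses not counted), where the
numbers in modulo counting quantifiers are written in binary. -/
def size : Formula P → ℕ
  | unary _ _ => 2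
  | nav _ _ _ => 3
  | equal _ _ => 3
  | neg φ => φ.size + 1
  | and φ ψ => φ.size + ψ.size + 1
  | or φ ψ => φ.size + ψ.size + 1
  | imp φ ψ => φ.size + ψ.size + 1
  | all _ φ => φ.size + 2
  | ex _ φ => φ.size + 2
  | exMod _ l k _ φ => φ.size + 3 + Nat.size k + Nat.size l

end Formula

/-! ### Ordered trees and semantics -/

/-- An unranked ordered tree with set of nodes `V`: a parent function under which every node is
reached from the only parentless node, the root, by finitely many child steps, and a strict order
on nodes which compares exactly the pairs of distinct siblings. -/
structure OrderedTree (V : Type*) where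
  root : V
  parent : V → Option V
  parent_eq_none : ∀ v, parent v = none ↔ v = root
  reachable : ∀ v, Relation.ReflTransGen (fun a b => parent b = some a) root v
  sibLT : V → V → Prop
  sibLT_irrefl : ∀ v, ¬ sibLT v v
  sibLT_trans : ∀ u v w, sibLT u v → sibLT v w → sibLT u w
  sibLT_iff : ∀ u v, (sibLT u v ∨ sibLT v u) ↔ u ≠ v ∧ parent u = parent v

namespace OrderedTree

variable {V : Type*} (T : OrderedTree V)

/-- `v` is a child of `u`. -/
def Child (u v : V) : Prop := T.parent v = some u

/-- `v` is the right sibling of `u`, i.e. the next one after `u` in the list of children of their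
common parent. -/
def RightSib (u v : V) : Prop := T.sibLT u v ∧ ∀ w, ¬ (T.sibLT u w ∧ T.sibLT w v)

/-- The interpretation of the navigational symbols. -/
def navRel : Nav → V → V → Prop
  | .child => T.Child
  | .desc => Relation.TransGen T.Child
  | .rightSib => T.RightSib
  | .followSib => Relation.TransGen T.RightSib

/-- The degree of a node: its number of children. -/
noncomputable def degree (v : V) : ℕ := {w | T.Child v w}.ncard

end OrderedTree

/-- A finite unranked ordered tree whose nodes are labelled by arbitrary sets of unary symbols
from `P`. -/
structure TreeStructure (P : Type*) where
  V : Type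
  finite : Finite V
  tree : OrderedTree V
  unary : P → V → Prop

/-- Satisfaction of a formula in a labelled tree under an assignment of the two variables. -/
def Formula.Realize {P : Type*} (M : TreeStructure P) : Formula P → (Var → M.V) → Prop
  | .unary p v, e => M.unary p (e v)
  | .nav r v w, e => M.tree.navRel r (e v) (e w)
  | .equal v w, e => e v = e w
  | .neg φ, e => ¬ φ.Realize M e
  | .and φ ψ, e => φ.Realize M e ∧ ψ.Realize M e
  | .or φ ψ, e => φ.Realize M e ∨ ψ.Realize M e
  | .imp φ ψ, e => φ.Realize M e → ψ.Realize M e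
  | .all v φ, e => ∀ b, φ.Realize M (Function.update e v b)
  | .ex v φ, e => ∃ b, φ.Realize M (Function.update e v b)
  | .exMod c l k v φ, e => c.holds ({b | φ.Realize M (Function.update e v b)}.ncard % l) k

/-- `M` is a model of `φ` (for sentences, the assignment is irrelevant). -/
def TreeStructure.Models {P : Type*} (M : TreeStructure P) (φ : Formula P) : Prop :=
  ∀ e : Var → M.V, φ.Realize M e

/-! ### Normal form and the bound -/

/-- The data of a formula in normal form:
`∀x∀y χ ∧ ⋀ i, ∀x∃y χᵢ ∧ ⋀ j, ∀x ∃^(⋈ⱼ kⱼ, lⱼ) y ψⱼ`. -/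
structure NormalForm (P : Type*) where
  n : ℕ
  m : ℕ
  n_ne_zero : n ≠ 0
  m_ne_zero : m ≠ 0
  chi : Formula P
  chis : Fin n → Formula P
  cmp : Fin m → Cmp
  l : Fin m → ℕ
  k : ∀ j, Fin (l j)
  psi : Fin m → Formula P
  cmp_ne_eq : ∀ j, cmp j ≠ Cmp.eq
  chi_qf : chi.QuantifierFree
  chis_qf : ∀ i, (chis i).QuantifierFree
  psi_qf : ∀ j, (psi j).QuantifierFree

/-- The ten order formulas on trees, describing the relative position of `x` and `y`. -/
inductive OrderFormula
  /-- `y` is a child of `x` -/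
  | down
  /-- `x` is a child of `y` -/
  | up
  /-- `y` is a descendant of `x` but not a child -/
  | farDown
  /-- `x` is a descendant of `y` but not a child -/
  | farUp
  /-- `y` is the right sibling of `x` -/
  | right
  /-- `x` is the right sibling of `y` -/
  | left
  /-- `y` is a following sibling of `x` but not its right sibling -/
  | farRight
  /-- `x` is a following sibling of `y` but not its right sibling -/
  | farLeft
  /-- `x` and `y` are in free position: distinct and related by no navigational symbol -/
  | free
  /-- `x` equals `y` -/
  | same
  deriving DecidableEq

instance : Fintype OrderFormula where
  elems := {.down, .up, .farDown, .farUp, .right, .left, .farRight, .farLeft, .free, .same}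
  complete := by intro θ; cases θ <;> decide

/-- Atomic one-types over the set `S` of unary symbols. In trees no node is in a navigational
relation to itself, so a one-type amounts to a truth assignment to the symbols of `S`. -/
abbrev OneType {P : Type*} (S : Set P) : Type _ := S → Bool

namespace NormalForm

variable {P : Type*} (φ : NormalForm P)

/-- The formula given by normal form data. -/
def toFormula : Formula P :=
  (List.ofFn (fun i => Formula.all .x (.ex .y (φ.chis i))) ++
    List.ofFn (fun j => Formula.all .x (.exMod (φ.cmp j) (φ.l j) (φ.k j) .y (φ.psi j)))).foldl
    Formula.and (.all .x (.all .y φ.chi))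

/-- The bound `f(φ) = (2 l₁ ⋯ lₘ) ^ (|Θ| |α|)`: the number of functions assigning to every order
formula and every one-type over the signature of `φ` an element of
`{0, 1} × ℤ_{l₁} × ⋯ × ℤ_{lₘ}`. -/
noncomputable def f : ℕ :=
  (2 * ∏ j, φ.l j) ^ (Fintype.card OrderFormula * Nat.card (OneType φ.toFormula.symbols))

end NormalForm

end FO2Mod

namespace FO2Mod

open Relation

namespace OrderedTree

variable {V : Type*} (T : OrderedTree V)

/-! ### Elementary facts on ordered trees -/

/-! A model with the fewest nodes already obeys the bounds. The forest of a node `u` consists of the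
subtrees of `u` and of its following siblings. Relative to `u`, every node gets a class: inside the
forest, whether it is `u`, a following sibling of `u`, or anything else; outside, its position
relative to `u`. The state of `u` records, for each class and one-type, whether the number of such
nodes is zero and its residues modulo the `l j`. There are at most `f(φ)` states.

Suppose `v ≠ u` lies in the forest of `u` and has the same state. Replace the forest of `u` by that
of `v`: the roots of the latter become children of the parent of `u`, to the right of its left
siblings. The position of an outer node relative to a forest node depends only on its position
relative to `u` and on the class of the forest node (`pos_crossing`, `graft_pos_crossing`). So a
surviving outer node sees inner classes of `v` instead of `u`, and a surviving inner node sees outer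
classes of `u` instead of `v`; all other pairs keep their positions. By equality of states, every
survivor sees the same numbers of nodes of each position and one-type, up to zero and the moduli
(`graft_ncard_key`). A normal form formula cannot detect more than this (`models_of_modEquiv`), so a
smaller model results.

In a minimal model, therefore, no node shares its state with another node of its forest. Forests
contain both descendants and following siblings, so states are distinct along a downward path and
among the children of a node. One surgery thus yields both bounds. -/

/-- `v` is a proper descendant of `u`. -/
abbrev Desc : V → V → Prop := TransGen T.Child

variable {T}

theorem parent_eq_of_sibLT {a b : V} (h : T.sibLT a b) : T.parent a = T.parent b :=
  ((T.sibLT_iff a b).1 (Or.inl h)).2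

theorem sibLT_asymm {a b : V} (h : T.sibLT a b) : ¬ T.sibLT b a :=
  fun h' => T.sibLT_irrefl a (T.sibLT_trans _ _ _ h h')

theorem sibLT_trichotomy {a b : V} (h : T.parent a = T.parent b) :
    T.sibLT a b ∨ a = b ∨ T.sibLT b a := by
  by_cases hab : a = b
  · exact Or.inr (Or.inl hab)
  · rcases (T.sibLT_iff a b).2 ⟨hab, h⟩ with h | h <;> simp [h]

theorem child_unique {a b c : V} (h : T.Child a c) (h' : T.Child b c) : a = b :=
  Option.some.inj (h.symm.trans h')

/-- A cycle through a node also passes through its unique parent. Induction along the path from the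
root pushes the cycle up to the root, which has no parent. -/
theorem desc_irrefl (a : V) : ¬ T.Desc a a := by
  induction T.reachable a with
  | refl =>
    intro h
    obtain ⟨c, -, hc⟩ := TransGen.tail'_iff.1 h
    have := (T.parent_eq_none T.root).2 rfl
    rw [Child, this] at hc
    cases hc
  | @tail b c _ hbc ih =>
    intro h
    obtain ⟨d, hd, hdc⟩ := TransGen.tail'_iff.1 h
    obtain rfl := child_unique hdc hbc
    exact ih (TransGen.head' hbc hd)

theorem desc_asymm {a b : V} (h : T.Desc a b) : ¬ T.Desc b a :=
  fun h' => desc_irrefl a (h.trans h')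

theorem desc_congr_right {a b c : V} (h : T.parent b = T.parent c) (hb : T.Desc a b) :
    T.Desc a c := by
  obtain ⟨d, hd, hdb⟩ := TransGen.tail'_iff.1 hb
  exact TransGen.tail' hd (h.symm.trans hdb)

theorem not_desc_of_parent_eq {a b : V} (h : T.parent a = T.parent b) : ¬ T.Desc a b :=
  fun h' => desc_irrefl a (desc_congr_right h.symm h')

theorem transGen_rightSib_iff [Finite V] {a b : V} :
    TransGen T.RightSib a b ↔ T.sibLT a b := by
  constructor
  · intro h
    induction h with
    | single h => exact h.1
    | tail _ h ih => exact T.sibLT_trans _ _ _ ih h.1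
  · have : IsTrans V T.sibLT := ⟨T.sibLT_trans⟩
    have : Std.Irrefl T.sibLT := ⟨T.sibLT_irrefl⟩
    have wf := Finite.wellFounded_of_trans_of_irrefl T.sibLT
    have wf' := Finite.wellFounded_of_trans_of_irrefl (Function.swap T.sibLT)
    induction b using wf.induction with
    | _ b ih =>
      intro h
      -- By finiteness there is a last sibling `c` from `a` on that precedes `b`; nothing lies
      -- between `c` and `b`.
      obtain ⟨c, ⟨hc, hcb⟩, hmax⟩ := wf'.has_min {c | (c = a ∨ T.sibLT a c) ∧ T.sibLT c b}
        ⟨a, Or.inl rfl, h⟩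
      have hr : T.RightSib c b := by
        refine ⟨hcb, fun w hw => hmax w ⟨Or.inr ?_, hw.2⟩ hw.1⟩
        rcases hc with rfl | hc
        · exact hw.1
        · exact T.sibLT_trans _ _ _ hc hw.1
      rcases hc with rfl | hc
      · exact TransGen.single hr
      · exact (ih c hcb hc).tail hr

/-! ### Relative positions -/

open scoped Classical in
variable (T) in
/-- The order formula satisfied by a pair of nodes. -/
noncomputable def pos (a b : V) : OrderFormula :=
  if a = b then .same
  else if T.Child a b then .down
  else if T.Child b a then .up
  else if T.Desc a b then .farDown
  else if T.Desc b a then .farUp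
  else if T.RightSib a b then .right
  else if T.RightSib b a then .left
  else if T.sibLT a b then .farRight
  else if T.sibLT b a then .farLeft
  else .free

end OrderedTree

/-- The order formula with the variables exchanged. -/
def OrderFormula.conv : OrderFormula → OrderFormula
  | .down => .up
  | .up => .down
  | .farDown => .farUp
  | .farUp => .farDown
  | .right => .left
  | .left => .right
  | .farRight => .farLeft
  | .farLeft => .farRight
  | .free => .free
  | .same => .same

namespace OrderedTree

variable {V : Type*} {T : OrderedTree V}

theorem pos_eq_same_iff {a b : V} : T.pos a b = .same ↔ a = b := by
  unfold pos; split_ifs <;> simp_all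

theorem pos_eq_down_iff {a b : V} : T.pos a b = .down ↔ T.Child a b := by
  have h : a = b → ¬ T.Child a b := by
    rintro rfl h; exact desc_irrefl a (.single h)
  unfold pos; split_ifs <;> simp_all

theorem pos_eq_up_iff {a b : V} : T.pos a b = .up ↔ T.Child b a := by
  have h : a = b → ¬ T.Child b a := by
    rintro rfl h; exact desc_irrefl a (.single h)
  have h' : T.Child a b → ¬ T.Child b a := fun h h' => desc_asymm (.single h) (.single h')
  unfold pos; split_ifs <;> simp_all

theorem pos_mem_desc_iff {a b : V} :
    (T.pos a b = .down ∨ T.pos a b = .farDown) ↔ T.Desc a b := by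
  have h : a = b → ¬ T.Desc a b := by
    rintro rfl h; exact desc_irrefl a h
  have h' : T.Child b a → ¬ T.Desc a b := fun h h' => desc_asymm (.single h) h'
  have h'' : T.Child a b → T.Desc a b := .single
  unfold pos; split_ifs <;> simp_all

theorem sibLT_not {a b : V} (h : T.sibLT a b) :
    a ≠ b ∧ ¬ T.Child a b ∧ ¬ T.Child b a ∧ ¬ T.Desc a b ∧ ¬ T.Desc b a ∧ ¬ T.RightSib b a := by
  have hp := parent_eq_of_sibLT h
  have h1 := not_desc_of_parent_eq hp
  have h2 := not_desc_of_parent_eq hp.symm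
  refine ⟨?_, fun h => h1 (.single h), fun h => h2 (.single h), h1, h2,
    fun h' => sibLT_asymm h h'.1⟩
  rintro rfl
  exact T.sibLT_irrefl _ h

theorem pos_eq_right_iff {a b : V} : T.pos a b = .right ↔ T.RightSib a b := by
  constructor
  · unfold pos; split_ifs <;> simp_all
  · intro h
    have := sibLT_not h.1
    simp [pos, this, h]

theorem pos_mem_sib_iff {a b : V} :
    (T.pos a b = .right ∨ T.pos a b = .farRight) ↔ T.sibLT a b := by
  constructor
  · unfold pos; split_ifs with _ _ _ _ _ h <;> simp_all
    exact h.1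
  · intro h
    have := sibLT_not h
    by_cases h' : T.RightSib a b <;> simp [pos, this, h, h']

/-- Allows pairs that cross the forest boundary to be analysed with the outer node first; the
reversed pairs follow by conversion. -/
theorem pos_conv (a b : V) : T.pos b a = (T.pos a b).conv := by
  by_cases h0 : a = b
  · subst h0; simp [pos, OrderFormula.conv]
  by_cases h1 : T.Child a b
  · have := desc_asymm (TransGen.single h1)
    have h : ¬ T.Child b a := fun h => this (.single h)
    simp [pos, h0, Ne.symm h0, h1, h, OrderFormula.conv]
  by_cases h2 : T.Child b a
  · simp [pos, h0, Ne.symm h0, h1, h2, OrderFormula.conv]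
  by_cases h3 : T.Desc a b
  · have := desc_asymm h3
    simp [pos, h0, Ne.symm h0, h1, h2, h3, this, OrderFormula.conv]
  by_cases h4 : T.Desc b a
  · simp [pos, h0, Ne.symm h0, h1, h2, h3, h4, OrderFormula.conv]
  by_cases h5 : T.RightSib a b
  · have := sibLT_not h5.1
    simp [pos, h0, Ne.symm h0, h1, h2, h3, h4, h5, this, OrderFormula.conv]
  by_cases h6 : T.RightSib b a
  · simp [pos, h0, Ne.symm h0, h1, h2, h3, h4, h5, h6, OrderFormula.conv]
  by_cases h7 : T.sibLT a b
  · have := sibLT_asymm h7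
    simp [pos, h0, Ne.symm h0, h1, h2, h3, h4, h5, h6, h7, this, OrderFormula.conv]
  by_cases h8 : T.sibLT b a <;>
    simp [pos, h0, Ne.symm h0, h1, h2, h3, h4, h5, h6, h7, h8, OrderFormula.conv]

open scoped Classical in
theorem pos_congr {V' : Type*} {T' : OrderedTree V'} {a b : V} {a' b' : V'}
    (h0 : a' = b' ↔ a = b)
    (h1 : T'.Child a' b' ↔ T.Child a b) (h1' : T'.Child b' a' ↔ T.Child b a)
    (h2 : T'.Desc a' b' ↔ T.Desc a b) (h2' : T'.Desc b' a' ↔ T.Desc b a)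
    (h3 : T'.RightSib a' b' ↔ T.RightSib a b) (h3' : T'.RightSib b' a' ↔ T.RightSib b a)
    (h4 : T'.sibLT a' b' ↔ T.sibLT a b) (h4' : T'.sibLT b' a' ↔ T.sibLT b a) :
    T'.pos a' b' = T.pos a b := by
  exact if_congr h0 rfl <| if_congr h1 rfl <| if_congr h1' rfl <| if_congr h2 rfl <|
    if_congr h2' rfl <| if_congr h3 rfl <| if_congr h3' rfl <| if_congr h4 rfl <|
    if_congr h4' rfl rfl

/-- The truth of a navigational atom at a pair of nodes depends on their relative position. -/
theorem navRel_congr [Finite V] {V' : Type*} [Finite V'] {T' : OrderedTree V'} {a b : V}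
    {a' b' : V'} (h : T'.pos a' b' = T.pos a b) (r : Nav) :
    T'.navRel r a' b' ↔ T.navRel r a b := by
  cases r <;> simp only [navRel]
  · rw [← pos_eq_down_iff, h, pos_eq_down_iff]
  · exact pos_mem_desc_iff.symm.trans (by rw [h]; exact pos_mem_desc_iff)
  · rw [← pos_eq_right_iff, h, pos_eq_right_iff]
  · rw [transGen_rightSib_iff, transGen_rightSib_iff, ← pos_mem_sib_iff, h, pos_mem_sib_iff]

/-! ### The forest of a node and its following siblings -/

variable (T) in
/-- `t` is `u` or a following sibling of `u`. -/
def Top (u t : V) : Prop := t = u ∨ T.sibLT u t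

variable (T) in
/-- `z` belongs to the subtree of `u` or of a following sibling of `u`. -/
def InForest (u z : V) : Prop := ∃ t, T.Top u t ∧ ReflTransGen T.Child t z

theorem Top.parent_eq {u t : V} (h : T.Top u t) : T.parent t = T.parent u := by
  rcases h with rfl | h
  · rfl
  · exact (parent_eq_of_sibLT h).symm

theorem Top.inForest {u t : V} (h : T.Top u t) : T.InForest u t := ⟨t, h, .refl⟩

theorem Top.of_sibLT {u a b : V} (h : T.Top u a) (hab : T.sibLT a b) : T.Top u b := by
  rcases h with rfl | h
  · exact Or.inr hab
  · exact Or.inr (T.sibLT_trans _ _ _ h hab)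

theorem top_refl (u : V) : T.Top u u := Or.inl rfl

theorem inForest_refl (u : V) : T.InForest u u := (top_refl u).inForest

theorem InForest.child {u a b : V} (h : T.InForest u a) (hab : T.Child a b) : T.InForest u b := by
  obtain ⟨t, ht, hta⟩ := h
  exact ⟨t, ht, hta.tail hab⟩

theorem InForest.reflTransGen {u a b : V} (h : T.InForest u a) (hab : ReflTransGen T.Child a b) :
    T.InForest u b := by
  obtain ⟨t, ht, hta⟩ := h
  exact ⟨t, ht, hta.trans hab⟩

theorem InForest.top_or_child {u a : V} (h : T.InForest u a) :
    T.Top u a ∨ ∃ c, T.Child c a ∧ T.InForest u c := by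
  obtain ⟨t, ht, hta⟩ := h
  rcases ReflTransGen.cases_tail hta with rfl | ⟨c, hc, hca⟩
  · exact Or.inl ht
  · exact Or.inr ⟨c, hca, t, ht, hc⟩

/-- Following siblings of a root of the forest are roots again; below the roots, siblings share a
parent inside the forest. This closure lets one surgery shorten sibling lists as well as paths. -/
theorem InForest.sibLT {u a b : V} (h : T.InForest u a) (hab : T.sibLT a b) : T.InForest u b := by
  rcases h.top_or_child with h | ⟨c, hca, hc⟩
  · exact (h.of_sibLT hab).inForest
  · exact hc.child ((parent_eq_of_sibLT hab).symm.trans hca)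

theorem InForest.trans {u v z : V} (h : T.InForest u v) (hz : T.InForest v z) :
    T.InForest u z := by
  obtain ⟨t, ht, htz⟩ := hz
  refine InForest.reflTransGen ?_ htz
  rcases ht with rfl | ht
  · exact h
  · exact h.sibLT ht

theorem not_inForest_of_child {u a : V} (h : T.Child a u) : ¬ T.InForest u a := by
  rintro ⟨t, ht, hta⟩
  exact desc_irrefl t (TransGen.tail' hta (ht.parent_eq.trans h))

theorem InForest.top_of_parent_eq {u a : V} (h : T.InForest u a) (hp : T.parent a = T.parent u) :
    T.Top u a := by
  rcases h.top_or_child with h | ⟨c, hca, hc⟩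
  · exact h
  · exact absurd hc (not_inForest_of_child (hp.symm.trans hca))

theorem not_inForest_of_sibLT {u a : V} (h : T.sibLT a u) : ¬ T.InForest u a := by
  intro h'
  rcases h'.top_of_parent_eq (parent_eq_of_sibLT h) with rfl | h'
  · exact T.sibLT_irrefl _ h
  · exact sibLT_asymm h h'

theorem not_inForest_root {u : V} (hu : u ≠ T.root) : ¬ T.InForest u T.root := by
  have hr := (T.parent_eq_none T.root).2 rfl
  intro h
  rcases h.top_or_child with h | ⟨c, hc, -⟩
  · exact hu ((T.parent_eq_none u).1 (h.parent_eq.symm.trans hr))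
  · rw [Child, hr] at hc; cases hc

/-! ### Relations between a node outside a forest and a node inside it -/

theorem child_crossing_iff {u a b : V} (ha : ¬ T.InForest u a) (hb : T.InForest u b) :
    T.Child a b ↔ T.Child a u ∧ T.Top u b := by
  constructor
  · intro h
    rcases hb.top_or_child with hb | ⟨c, hcb, hc⟩
    · exact ⟨hb.parent_eq.symm.trans h, hb⟩
    · exact absurd (child_unique hcb h ▸ hc) ha
  · rintro ⟨h, h'⟩
    exact h'.parent_eq.trans h

theorem sibLT_crossing_iff {u a b : V} (ha : ¬ T.InForest u a) (hb : T.InForest u b) :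
    T.sibLT a b ↔ T.sibLT a u ∧ T.Top u b := by
  constructor
  · intro h
    have hp := parent_eq_of_sibLT h
    rcases hb.top_or_child with hb | ⟨c, hcb, hc⟩
    · refine ⟨?_, hb⟩
      rcases sibLT_trichotomy (hp.trans hb.parent_eq) with h | rfl | h
      · exact h
      · exact absurd (inForest_refl _) ha
      · exact absurd ((inForest_refl u).sibLT h) ha
    · exact absurd (hc.child (hp.trans hcb)) ha
  · rintro ⟨h, rfl | h'⟩
    · exact h
    · exact T.sibLT_trans _ _ _ h h'

/-- Climbing from `b`, one leaves the forest through a root, and all roots have the same parent as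
`u`. -/
theorem desc_crossing_iff {u a b : V} (ha : ¬ T.InForest u a) (hb : T.InForest u b) :
    T.Desc a b ↔ T.Desc a u := by
  obtain ⟨t, ht, htb⟩ := hb
  constructor
  · intro h
    induction htb with
    | refl => exact desc_congr_right ht.parent_eq h
    | @tail c d htc hcd ih =>
      obtain ⟨e, hae, hed⟩ := TransGen.tail'_iff.1 h
      obtain rfl := child_unique hed hcd
      rcases reflTransGen_iff_eq_or_transGen.1 hae with rfl | hae
      · exact absurd ⟨t, ht, htc⟩ ha
      · exact ih hae
  · intro h
    exact (desc_congr_right ht.parent_eq.symm h).trans_left htb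

theorem rightSib_crossing_iff {u a b : V} (ha : ¬ T.InForest u a) (hb : T.InForest u b) :
    T.RightSib a b ↔ T.RightSib a u ∧ b = u := by
  constructor
  · intro h
    obtain ⟨h1, h2⟩ := (sibLT_crossing_iff ha hb).1 h.1
    rcases h2 with rfl | h2
    · exact ⟨h, rfl⟩
    · exact absurd ⟨h1, h2⟩ (h.2 u)
  · rintro ⟨h, rfl⟩
    exact h

theorem not_crossing_back {u a b : V} (ha : ¬ T.InForest u a) (hb : T.InForest u b) :
    a ≠ b ∧ ¬ T.Child b a ∧ ¬ T.Desc b a ∧ ¬ T.sibLT b a := by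
  refine ⟨?_, fun h => ha (hb.child h), fun h => ha (hb.reflTransGen h.to_reflTransGen),
    fun h => ha (hb.sibLT h)⟩
  rintro rfl
  exact ha hb

open scoped Classical in
variable (T) in
/-- The class of a node `z` relative to `u`. The nodes of the forest of `u` are divided into `u`,
its following siblings, and all others; the nodes outside are classified by their position. -/
noncomputable def cls (u z : V) : OrderFormula :=
  if T.InForest u z then
    -- Here `right` covers all following siblings and `down` all remaining forest nodes, including
    -- proper descendants of `u` and of its siblings.
    if z = u then .same else if T.sibLT u z then .right else .down
  else T.pos u z

end OrderedTree

/-- The classes used for the nodes of the forest of a node. -/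
def OrderFormula.inner : OrderFormula → Prop
  | .same | .right | .down => True
  | _ => False

/-- The position of a node `a` outside the forest of `u` relative to a node of class `c` of this
forest, in terms of its position `θ` relative to `u`. -/
def OrderFormula.extend : OrderFormula → OrderFormula → OrderFormula
  | .down, .same => .down
  | .down, .right => .down
  | .down, _ => .farDown
  | .farDown, _ => .farDown
  | .right, .same => .right
  | .right, .right => .farRight
  | .farRight, .same => .farRight
  | .farRight, .right => .farRight
  | _, _ => .free

namespace OrderedTree

variable {V : Type*} {T : OrderedTree V}

/-- An outer node is never `u`, its right sibling or its child, so these three labels are free for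
reuse inside. Ten labels therefore suffice, which is what keeps the number of states at `f(φ)`. -/
theorem cls_inner_iff {u z : V} : (T.cls u z).inner ↔ T.InForest u z := by
  unfold cls
  split_ifs with h h1 h2
  · simp [h, OrderFormula.inner]
  · simp [h, OrderFormula.inner]
  · simp [h, OrderFormula.inner]
  · simp only [h, iff_false]
    have h1 : T.pos u z ≠ .same := fun e => h (pos_eq_same_iff.1 e ▸ inForest_refl u)
    have h2 : T.pos u z ≠ .right := fun e => h ((inForest_refl u).sibLT (pos_eq_right_iff.1 e).1)
    have h3 : T.pos u z ≠ .down := fun e => h ((inForest_refl u).child (pos_eq_down_iff.1 e))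
    revert h1 h2 h3
    cases T.pos u z <;> simp [OrderFormula.inner]

theorem cls_of_not_inForest {u z : V} (h : ¬ T.InForest u z) : T.cls u z = T.pos u z :=
  if_neg h

theorem cls_eq_same_iff {u z : V} : T.cls u z = .same ↔ z = u := by
  unfold cls
  split_ifs with h h1 h2
  · simp [h1]
  · simp [h1]
  · simp [h1]
  · rw [pos_eq_same_iff, eq_comm]

theorem cls_eq_up_iff {u z : V} : T.cls u z = .up ↔ T.Child z u := by
  unfold cls
  split_ifs with h h1 h2
  · simpa using fun h' => not_inForest_of_child h' h
  · simpa using fun h' => not_inForest_of_child h' h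
  · simpa using fun h' => not_inForest_of_child h' h
  · rw [pos_eq_up_iff]

theorem top_iff_cls {u z : V} (hz : T.InForest u z) :
    T.Top u z ↔ T.cls u z = .same ∨ T.cls u z = .right := by
  unfold cls Top
  split_ifs with h1 h2 <;> simp [*]

/-- The second tree is needed because the same table is used twice: in the original tree, and in the
tree after replacement, where `v` stands in for `u`. -/
theorem pos_eq_extend {V' : Type*} {T' : OrderedTree V'} {a' b' : V'} {a u : V} {c : OrderFormula}
    (ha : ¬ T.InForest u a) (hback : a' ≠ b' ∧ ¬ T'.Child b' a' ∧ ¬ T'.Desc b' a' ∧ ¬ T'.sibLT b' a')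
    (hc : c.inner)
    (h1 : T'.Child a' b' ↔ T.Child a u ∧ (c = .same ∨ c = .right))
    (h2 : T'.Desc a' b' ↔ T.Desc a u)
    (h3 : T'.sibLT a' b' ↔ T.sibLT a u ∧ (c = .same ∨ c = .right))
    (h4 : T'.RightSib a' b' ↔ T.RightSib a u ∧ c = .same) :
    T'.pos a' b' = (T.pos a u).extend c := by
  obtain ⟨b0, b1, b2, b3⟩ := hback
  have b4 : ¬ T'.RightSib b' a' := fun h => b3 h.1
  obtain ⟨d0, d1, d2, d3⟩ := not_crossing_back ha (inForest_refl u)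
  have d4 : ¬ T.RightSib u a := fun h => d3 h.1
  have e1 : T.Child a u → T.Desc a u := .single
  have e2 : T.RightSib a u → T.sibLT a u := fun h => h.1
  simp only [pos, b0, b1, b2, b3, b4, d0, d1, d2, d3, d4, h1, h2, h3, h4, if_false]
  cases c <;> simp only [OrderFormula.inner] at hc <;>
    by_cases c1 : T.Child a u <;> by_cases c2 : T.Desc a u <;> by_cases c3 : T.RightSib a u <;>
    by_cases c4 : T.sibLT a u <;> simp_all [OrderFormula.extend]

theorem pos_crossing {u a b : V} (ha : ¬ T.InForest u a) (hb : T.InForest u b) :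
    T.pos a b = (T.pos a u).extend (T.cls u b) := by
  refine pos_eq_extend ha (not_crossing_back ha hb) (cls_inner_iff.2 hb) ?_
    (desc_crossing_iff ha hb) ?_ ?_
  · rw [← top_iff_cls hb, child_crossing_iff ha hb]
  · rw [← top_iff_cls hb, sibLT_crossing_iff ha hb]
  · rw [cls_eq_same_iff, rightSib_crossing_iff ha hb]

end OrderedTree

end FO2Mod

namespace FO2Mod

open Relation

namespace OrderedTree

variable {V : Type*} (T : OrderedTree V)

/-! ### Replacing the forest of `u` by the forest of a node `v` inside it -/

/-- The nodes which remain when the forest of `u` is replaced by the forest of `v`. -/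
abbrev Remaining (u v : V) : Type _ := {z : V // ¬ T.InForest u z ∨ T.InForest v z}

open scoped Classical in
/-- The parent function after the forest of `u` is replaced by the forest of `v`. -/
noncomputable def graftParent (u v : V) (z : T.Remaining u v) : Option (T.Remaining u v) :=
  -- The inner `none` is a dummy: when `v` lies in the forest of `u`, the prescribed parent always
  -- survives, so only the root ends up without a parent.
  (if T.Top v z.1 then T.parent u else T.parent z.1).bind
    fun a => if h : ¬ T.InForest u a ∨ T.InForest v a then some ⟨a, h⟩ else none

/-- The sibling order after the forest of `u` is replaced by the forest of `v`. -/
def GraftLT (u v a b : V) : Prop := T.sibLT a b ∨ T.Top v b ∧ T.sibLT a u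

variable {T} {u v : V}

theorem graftParent_eq_some_iff {a b : T.Remaining u v} :
    T.graftParent u v b = some a ↔
      (T.Top v b.1 ∧ T.parent u = some a.1) ∨ (¬ T.Top v b.1 ∧ T.parent b.1 = some a.1) := by
  unfold graftParent
  rw [Option.bind_eq_some_iff]
  constructor
  · rintro ⟨c, hc, h⟩
    split_ifs at h with hS
    obtain rfl := Option.some.inj h
    split_ifs at hc with ht <;> simp [ht, hc]
  · rintro (⟨h, h'⟩ | ⟨h, h'⟩)
    · exact ⟨a.1, by simp [h, h'], by simp [a.2]⟩
    · exact ⟨a.1, by simp [h, h'], by simp [a.2]⟩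

/-- As the prescribed parents survive, no two distinct values are both turned into `none`; comparing
parents may be done in the original tree. -/
theorem graftParent_eq_iff {a b : T.Remaining u v} {p q : Option V}
    (hp : ∀ c, T.graftParent u v a = some c ↔ p = some c.1)
    (hq : ∀ c, T.graftParent u v b = some c ↔ q = some c.1)
    (hp' : ∀ c, p = some c → ¬ T.InForest u c ∨ T.InForest v c)
    (hq' : ∀ c, q = some c → ¬ T.InForest u c ∨ T.InForest v c) :
    T.graftParent u v a = T.graftParent u v b ↔ p = q := by
  have key : ∀ {z : T.Remaining u v} {r : Option V}
      (_ : ∀ c, T.graftParent u v z = some c ↔ r = some c.1)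
      (_ : ∀ c, r = some c → ¬ T.InForest u c ∨ T.InForest v c),
      r = (T.graftParent u v z).map Subtype.val := by
    intro z r hr hr'
    cases h : T.graftParent u v z with
    | some c => simpa using (hr c).1 h
    | none =>
      cases h' : r with
      | none => rfl
      | some c =>
        have := (hr ⟨c, hr' c h'⟩).2 h'
        rw [h] at this
        cases this
  rw [key hp hp', key hq hq']
  exact (Option.map_injective Subtype.val_injective).eq_iff.symm

theorem remaining_of_child {a b : V} (hb : ¬ T.InForest u b ∨ T.InForest v b) (ht : ¬ T.Top v b)
    (hab : T.Child a b) : ¬ T.InForest u a ∨ T.InForest v a := by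
  rcases hb with hb | hb
  · exact Or.inl fun h => hb (h.child hab)
  · rcases hb.top_or_child with h | ⟨c, hcb, hc⟩
    · exact absurd h ht
    · exact Or.inr (child_unique hcb hab ▸ hc)

theorem graftParent_of_top {b : T.Remaining u v} (hb : T.Top v b.1) (c : T.Remaining u v) :
    T.graftParent u v b = some c ↔ T.parent u = some c.1 := by
  simp [graftParent_eq_some_iff, hb]

theorem graftParent_of_not_top {b : T.Remaining u v} (hb : ¬ T.Top v b.1) (c : T.Remaining u v) :
    T.graftParent u v b = some c ↔ T.parent b.1 = some c.1 := by
  simp [graftParent_eq_some_iff, hb]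

theorem not_top_of_not_inForest {b : V} (huv : T.InForest u v) (hb : ¬ T.InForest u b) :
    ¬ T.Top v b := fun h => hb (huv.trans h.inForest)

theorem graftLT_iff_of_not_inForest {a b : V} (huv : T.InForest u v) (hb : ¬ T.InForest u b) :
    T.GraftLT u v a b ↔ T.sibLT a b := by
  simp [GraftLT, not_top_of_not_inForest huv hb]

theorem graftLT_iff_of_inForest {a b : V} (huv : T.InForest u v) (ha : T.InForest v a) :
    T.GraftLT u v a b ↔ T.sibLT a b := by
  have h : ¬ T.sibLT a u := fun h => not_inForest_of_sibLT h (huv.trans ha)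
  simp [GraftLT, h]

theorem graftLT_crossing_iff {a b : V} (huv : T.InForest u v) (ha : ¬ T.InForest u a)
    (hb : T.InForest v b) : T.GraftLT u v a b ↔ T.sibLT a u ∧ T.Top v b := by
  have ha' : ¬ T.InForest v a := fun h => ha (huv.trans h)
  constructor
  · rintro (h | h)
    · exact ⟨((sibLT_crossing_iff ha (huv.trans hb)).1 h).1, ((sibLT_crossing_iff ha' hb).1 h).2⟩
    · exact h.symm
  · exact fun h => Or.inr h.symm

theorem graftLT_irrefl (huv : T.InForest u v) (a : V) : ¬ T.GraftLT u v a a := by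
  rintro (h | ⟨h, h'⟩)
  · exact T.sibLT_irrefl a h
  · exact not_inForest_of_sibLT h' (huv.trans h.inForest)

theorem graftLT_trans {a b c : V} (h : T.GraftLT u v a b) (h' : T.GraftLT u v b c) :
    T.GraftLT u v a c := by
  rcases h with h | ⟨h1, h2⟩ <;> rcases h' with h' | ⟨h1', h2'⟩
  · exact Or.inl (T.sibLT_trans _ _ _ h h')
  · exact Or.inr ⟨h1', T.sibLT_trans _ _ _ h h2'⟩
  · exact Or.inr ⟨h1.of_sibLT h', h2⟩
  · exact Or.inr ⟨h1', h2⟩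

/-- An outer sibling of `u` must precede `u`, hence now precedes `a`. For an inner `b` that is not a
root both sides fail: its parent lies in the forest of `u`, but the parent of `u` does not. -/
theorem graftLT_or_iff_of_top {a b : V} (huv : T.InForest u v) (ha : T.Top v a)
    (hb : ¬ T.Top v b) (hb' : ¬ T.InForest u b ∨ T.InForest v b) :
    (T.GraftLT u v a b ∨ T.GraftLT u v b a) ↔ T.parent u = T.parent b := by
  rw [graftLT_iff_of_inForest huv ha.inForest]
  have hab : ¬ T.sibLT a b := fun h => hb (ha.of_sibLT h)
  rcases hb' with hb' | hb'
  · rw [graftLT_crossing_iff huv hb' ha.inForest]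
    constructor
    · rintro (h | h)
      · exact absurd h hab
      · exact (parent_eq_of_sibLT h.1).symm
    · intro h
      rcases sibLT_trichotomy h with h | rfl | h
      · exact absurd ((inForest_refl u).sibLT h) hb'
      · exact absurd (inForest_refl _) hb'
      · exact Or.inr ⟨h, ha⟩
  · rw [graftLT_iff_of_inForest huv hb']
    constructor
    · rintro (h | h)
      · exact absurd h hab
      · exact absurd (hb'.top_of_parent_eq ((parent_eq_of_sibLT h).trans ha.parent_eq)) hb
    · intro h
      obtain ⟨c, hcb, hc⟩ := hb'.top_or_child.resolve_left hb
      exact absurd (huv.trans hc) (not_inForest_of_child (h.trans hcb))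

theorem graftLT_or_iff (huv : T.InForest u v) (a b : T.Remaining u v) :
    (T.GraftLT u v a.1 b.1 ∨ T.GraftLT u v b.1 a.1) ↔
      a ≠ b ∧ T.graftParent u v a = T.graftParent u v b := by
  have hpu : ∀ c, T.parent u = some c → ¬ T.InForest u c ∨ T.InForest v c :=
    fun c h => Or.inl (not_inForest_of_child h)
  have hp : ∀ b : T.Remaining u v, ¬ T.Top v b.1 → ∀ c, T.parent b.1 = some c →
      ¬ T.InForest u c ∨ T.InForest v c := fun b hb c h => remaining_of_child b.2 hb h
  by_cases ha : T.Top v a.1 <;> by_cases hb : T.Top v b.1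
  · rw [graftLT_iff_of_inForest huv ha.inForest, graftLT_iff_of_inForest huv hb.inForest,
      graftParent_eq_iff (graftParent_of_top ha) (graftParent_of_top hb) hpu hpu, T.sibLT_iff,
      ha.parent_eq, hb.parent_eq, Ne, Ne, Subtype.ext_iff]
    simp
  · rw [graftLT_or_iff_of_top huv ha hb b.2,
      graftParent_eq_iff (graftParent_of_top ha) (graftParent_of_not_top hb) hpu (hp b hb)]
    exact ⟨fun h => ⟨fun e => hb (e ▸ ha), h⟩, And.right⟩
  · rw [or_comm, graftLT_or_iff_of_top huv hb ha a.2,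
      graftParent_eq_iff (graftParent_of_not_top ha) (graftParent_of_top hb) (hp a ha) hpu]
    exact ⟨fun h => ⟨fun e => ha (e ▸ hb), h.symm⟩, fun h => h.2.symm⟩
  · rw [graftParent_eq_iff (graftParent_of_not_top ha) (graftParent_of_not_top hb)
      (hp a ha) (hp b hb), Ne, Subtype.ext_iff, ← Ne, ← T.sibLT_iff]
    simp [GraftLT, ha, hb]

theorem graft_reachable_outer (huv : T.InForest u v) (hu : u ≠ T.root) (z : V)
    (hz : ¬ T.InForest u z) :
    ReflTransGen (fun a b : T.Remaining u v => T.graftParent u v b = some a)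
      ⟨T.root, Or.inl (not_inForest_root hu)⟩ ⟨z, Or.inl hz⟩ := by
  induction T.reachable z with
  | refl => exact .refl
  | @tail b c _ hbc ih =>
    have hb : ¬ T.InForest u b := fun h => hz (h.child hbc)
    exact (ih hb).tail ((graftParent_of_not_top (not_top_of_not_inForest huv hz) _).2 hbc)

theorem graft_reachable_inner {r : T.Remaining u v} {t z : V} (ht : T.Top v t)
    (h : ReflTransGen (fun a b : T.Remaining u v => T.graftParent u v b = some a) r
      ⟨t, Or.inr ht.inForest⟩) (htz : ReflTransGen T.Child t z) :
    ReflTransGen (fun a b : T.Remaining u v => T.graftParent u v b = some a) r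
      ⟨z, Or.inr ⟨t, ht, htz⟩⟩ := by
  induction htz with
  | refl => exact h
  | @tail b c htb hbc ih =>
    refine ih.tail ((graftParent_of_not_top (fun hc => ?_) _).2 hbc)
    exact not_inForest_of_child (hc.parent_eq.symm.trans hbc) ⟨t, ht, htb⟩

theorem exists_parent (hu : u ≠ T.root) : ∃ p, T.Child p u := by
  cases h : T.parent u with
  | none => exact absurd ((T.parent_eq_none u).1 h) hu
  | some p => exact ⟨p, h⟩

variable (T) in
/-- The tree obtained by replacing the forest of `u` by the forest of one of its nodes `v`. -/
noncomputable def graft (u v : V) (huv : T.InForest u v) (hu : u ≠ T.root) :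
    OrderedTree (T.Remaining u v) where
  root := ⟨T.root, Or.inl (not_inForest_root hu)⟩
  parent := T.graftParent u v
  parent_eq_none z := by
    constructor
    · intro h
      by_cases hz : T.Top v z.1
      · obtain ⟨p, hp⟩ := exists_parent hu
        have := (graftParent_of_top hz ⟨p, Or.inl (not_inForest_of_child hp)⟩).2 hp
        rw [h] at this
        cases this
      · by_contra hne
        obtain ⟨p, hp⟩ := exists_parent (T := T) (u := z.1) fun e => hne (Subtype.ext e)
        have := (graftParent_of_not_top hz ⟨p, remaining_of_child z.2 hz hp⟩).2 hp
        rw [h] at this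
        cases this
    · rintro rfl
      rw [Option.eq_none_iff_forall_ne_some]
      intro c hc
      rw [graftParent_of_not_top (not_top_of_not_inForest huv (not_inForest_root hu)),
        (T.parent_eq_none _).2 rfl] at hc
      cases hc
  reachable z := by
    obtain ⟨z, hz | hz⟩ := z
    · exact graft_reachable_outer huv hu z hz
    · obtain ⟨t, ht, htz⟩ := id hz
      obtain ⟨p, hp⟩ := exists_parent hu
      exact graft_reachable_inner ht ((graft_reachable_outer huv hu p
        (not_inForest_of_child hp)).tail ((graftParent_of_top ht _).2 hp)) htz
  sibLT a b := T.GraftLT u v a.1 b.1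
  sibLT_irrefl a := graftLT_irrefl huv a.1
  sibLT_trans _ _ _ h h' := graftLT_trans h h'
  sibLT_iff := graftLT_or_iff huv

/-! ### Navigation and positions in the grafted tree -/

variable {huv : T.InForest u v} {hu : u ≠ T.root}

theorem graft_child_iff {a b : T.Remaining u v} (hb : ¬ T.Top v b.1) :
    (T.graft u v huv hu).Child a b ↔ T.Child a.1 b.1 :=
  graftParent_of_not_top hb a

theorem graft_child_iff_of_top {a b : T.Remaining u v} (hb : T.Top v b.1) :
    (T.graft u v huv hu).Child a b ↔ T.Child a.1 u :=
  graftParent_of_top hb a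

theorem graft_child_outer {a b : T.Remaining u v} (hb : ¬ T.InForest u b.1) :
    (T.graft u v huv hu).Child a b ↔ T.Child a.1 b.1 :=
  graft_child_iff (not_top_of_not_inForest huv hb)

theorem graft_child_inner {a b : T.Remaining u v} (ha : T.InForest v a.1) :
    (T.graft u v huv hu).Child a b ↔ T.Child a.1 b.1 := by
  by_cases hb : T.Top v b.1
  · rw [graft_child_iff_of_top hb]
    exact iff_of_false (fun h => not_inForest_of_child h (huv.trans ha))
      fun h => not_inForest_of_child (hb.parent_eq.symm.trans h) ha
  · exact graft_child_iff hb

theorem graft_child_crossing {a b : T.Remaining u v} (ha : ¬ T.InForest u a.1)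
    (hb : T.InForest v b.1) :
    (T.graft u v huv hu).Child a b ↔ T.Child a.1 u ∧ T.Top v b.1 := by
  by_cases hb' : T.Top v b.1
  · simp [graft_child_iff_of_top hb', hb']
  · rw [graft_child_iff hb', child_crossing_iff (fun h => ha (huv.trans h)) hb]
    simp [hb']

theorem graft_desc_outer {a b : T.Remaining u v} (hb : ¬ T.InForest u b.1) :
    (T.graft u v huv hu).Desc a b ↔ T.Desc a.1 b.1 := by
  constructor
  · intro h
    induction h with
    | single h => exact .single ((graft_child_outer hb).1 h)
    | @tail c d _ h ih =>
      have h' := (graft_child_outer hb).1 h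
      exact (ih fun hc => hb (hc.child h')).tail h'
  · obtain ⟨b, hb0⟩ := b
    intro h
    change T.Desc a.1 b at h
    induction h with
    | single h => exact .single ((graft_child_outer hb).2 h)
    | @tail c d _ h ih =>
      have hc : ¬ T.InForest u c := fun hc => hb (hc.child h)
      exact (ih (Or.inl hc) hc).tail ((graft_child_outer hb).2 h)

theorem graft_desc_inner {a b : T.Remaining u v} (ha : T.InForest v a.1) :
    (T.graft u v huv hu).Desc a b ↔ T.Desc a.1 b.1 := by
  constructor
  · intro h
    suffices T.Desc a.1 b.1 ∧ T.InForest v b.1 from this.1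
    induction h with
    | single h =>
      have h' := (graft_child_inner ha).1 h
      exact ⟨.single h', ha.child h'⟩
    | @tail c d _ h ih =>
      have h' := (graft_child_inner ih.2).1 h
      exact ⟨ih.1.tail h', ih.2.child h'⟩
  · obtain ⟨b, hb0⟩ := b
    intro h
    change T.Desc a.1 b at h
    induction h with
    | single h => exact .single ((graft_child_inner ha).2 h)
    | @tail c d hac h ih =>
      have hc : T.InForest v c := ha.reflTransGen hac.to_reflTransGen
      exact (ih (Or.inr hc)).tail ((graft_child_inner hc).2 h)

theorem graft_desc_crossing {a b : T.Remaining u v} (ha : ¬ T.InForest u a.1)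
    (hb : T.InForest v b.1) :
    (T.graft u v huv hu).Desc a b ↔ T.Desc a.1 u := by
  constructor
  · intro h
    induction h with
    | single h => exact .single ((graft_child_crossing ha hb).1 h).1
    | @tail c d hac h ih =>
      rcases c.2 with hc | hc
      · exact TransGen.tail ((graft_desc_outer hc).1 hac) ((graft_child_crossing hc hb).1 h).1
      · exact ih hc
  · intro h
    obtain ⟨c, hac, hcu⟩ := TransGen.tail'_iff.1 h
    have hc := not_inForest_of_child hcu
    obtain ⟨b, hb0⟩ := b
    obtain ⟨t, ht, htb⟩ := id hb
    have hac' : ReflTransGen (T.graft u v huv hu).Child a ⟨c, Or.inl hc⟩ := by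
      rcases reflTransGen_iff_eq_or_transGen.1 hac with rfl | hac
      · exact .refl
      · exact ((graft_desc_outer hc).2 hac).to_reflTransGen
    have hat : (T.graft u v huv hu).Desc a ⟨t, Or.inr ht.inForest⟩ :=
      TransGen.tail' hac' ((graft_child_iff_of_top ht).2 hcu)
    exact hat.trans_left (graft_reachable_inner ht .refl htb)

theorem graft_sibLT_outer {a b : T.Remaining u v} (hb : ¬ T.InForest u b.1) :
    (T.graft u v huv hu).sibLT a b ↔ T.sibLT a.1 b.1 :=
  graftLT_iff_of_not_inForest huv hb

theorem graft_sibLT_inner {a b : T.Remaining u v} (ha : T.InForest v a.1) :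
    (T.graft u v huv hu).sibLT a b ↔ T.sibLT a.1 b.1 :=
  graftLT_iff_of_inForest huv ha

theorem graft_sibLT_crossing {a b : T.Remaining u v} (ha : ¬ T.InForest u a.1)
    (hb : T.InForest v b.1) :
    (T.graft u v huv hu).sibLT a b ↔ T.sibLT a.1 u ∧ T.Top v b.1 :=
  graftLT_crossing_iff huv ha hb

theorem graft_rightSib_outer {a b : T.Remaining u v} (hb : ¬ T.InForest u b.1) :
    (T.graft u v huv hu).RightSib a b ↔ T.RightSib a.1 b.1 := by
  refine and_congr (graft_sibLT_outer hb) ⟨fun h w hw => ?_, fun h w hw => ?_⟩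
  · have hw' : ¬ T.InForest u w := fun h => hb (h.sibLT hw.2)
    exact h ⟨w, Or.inl hw'⟩ ⟨(graft_sibLT_outer hw').2 hw.1, (graft_sibLT_outer hb).2 hw.2⟩
  · have hwb := (graft_sibLT_outer hb).1 hw.2
    have hw' : ¬ T.InForest u w.1 := fun h => hb (h.sibLT hwb)
    exact h w.1 ⟨(graft_sibLT_outer hw').1 hw.1, hwb⟩

theorem graft_rightSib_inner {a b : T.Remaining u v} (ha : T.InForest v a.1) :
    (T.graft u v huv hu).RightSib a b ↔ T.RightSib a.1 b.1 := by
  refine and_congr (graft_sibLT_inner ha) ⟨fun h w hw => ?_, fun h w hw => ?_⟩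
  · have hw' : T.InForest v w := ha.sibLT hw.1
    exact h ⟨w, Or.inr hw'⟩ ⟨(graft_sibLT_inner ha).2 hw.1, (graft_sibLT_inner hw').2 hw.2⟩
  · have haw := (graft_sibLT_inner ha).1 hw.1
    exact h w.1 ⟨haw, (graft_sibLT_inner (ha.sibLT haw)).1 hw.2⟩

/-- `v` takes the place of `u` as first root. An outer node between `a` and `v` would lie between
`a` and `u`; an inner one would be a node of the forest of `v` preceding `v`. -/
theorem graft_rightSib_crossing {a b : T.Remaining u v} (ha : ¬ T.InForest u a.1)
    (hb : T.InForest v b.1) :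
    (T.graft u v huv hu).RightSib a b ↔ T.RightSib a.1 u ∧ b.1 = v := by
  constructor
  · rintro ⟨h, h'⟩
    obtain ⟨hau, hvb⟩ := (graft_sibLT_crossing ha hb).1 h
    refine ⟨⟨hau, fun w hw => ?_⟩, hvb.resolve_right fun hvb => ?_⟩
    · have hw' := not_inForest_of_sibLT hw.2
      exact h' ⟨w, Or.inl hw'⟩ ⟨(graft_sibLT_outer hw').2 hw.1,
        (graft_sibLT_crossing hw' hb).2 ⟨hw.2, hvb⟩⟩
    · exact h' ⟨v, Or.inr (inForest_refl v)⟩ ⟨(graft_sibLT_crossing ha (inForest_refl v)).2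
        ⟨hau, top_refl v⟩, (graft_sibLT_inner (inForest_refl v)).2 hvb⟩
  · rintro ⟨h, hbv⟩
    refine ⟨(graft_sibLT_crossing ha hb).2 ⟨h.1, Or.inl hbv⟩, fun w hw => ?_⟩
    rcases w.2 with hw' | hw'
    · exact h.2 w.1 ⟨(graft_sibLT_outer hw').1 hw.1, ((graft_sibLT_crossing hw' hb).1 hw.2).1⟩
    · have hwv := (graft_sibLT_inner hw').1 hw.2
      rw [hbv] at hwv
      exact not_inForest_of_sibLT hwv hw'

theorem graft_not_crossing_back {a b : T.Remaining u v} (ha : ¬ T.InForest u a.1)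
    (hb : T.InForest v b.1) : a ≠ b ∧ ¬ (T.graft u v huv hu).Child b a ∧
      ¬ (T.graft u v huv hu).Desc b a ∧ ¬ (T.graft u v huv hu).sibLT b a := by
  rw [graft_child_outer ha, graft_desc_outer ha, graft_sibLT_outer ha]
  obtain ⟨h0, h⟩ := not_crossing_back ha (huv.trans hb)
  exact ⟨fun e => h0 (congrArg _ e), h⟩

theorem graft_pos_outer {a b : T.Remaining u v} (ha : ¬ T.InForest u a.1)
    (hb : ¬ T.InForest u b.1) : (T.graft u v huv hu).pos a b = T.pos a.1 b.1 :=
  pos_congr Subtype.ext_iff (graft_child_outer hb) (graft_child_outer ha)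
    (graft_desc_outer hb) (graft_desc_outer ha) (graft_rightSib_outer hb)
    (graft_rightSib_outer ha) (graft_sibLT_outer hb) (graft_sibLT_outer ha)

theorem graft_pos_inner {a b : T.Remaining u v} (ha : T.InForest v a.1)
    (hb : T.InForest v b.1) : (T.graft u v huv hu).pos a b = T.pos a.1 b.1 :=
  pos_congr Subtype.ext_iff (graft_child_inner ha) (graft_child_inner hb)
    (graft_desc_inner ha) (graft_desc_inner hb) (graft_rightSib_inner ha)
    (graft_rightSib_inner hb) (graft_sibLT_inner ha) (graft_sibLT_inner hb)

theorem graft_pos_crossing {a b : T.Remaining u v} (ha : ¬ T.InForest u a.1)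
    (hb : T.InForest v b.1) :
    (T.graft u v huv hu).pos a b = (T.pos a.1 u).extend (T.cls v b.1) := by
  refine pos_eq_extend ha (graft_not_crossing_back ha hb) (cls_inner_iff.2 hb) ?_
    (graft_desc_crossing ha hb) ?_ ?_
  · rw [← top_iff_cls hb, graft_child_crossing ha hb]
  · rw [← top_iff_cls hb, graft_sibLT_crossing ha hb]
  · rw [cls_eq_same_iff, graft_rightSib_crossing ha hb]

end OrderedTree

end FO2Mod

namespace FO2Mod

/-! ### Counting up to zero and the given moduli -/

/-- Two numbers are both zero or both nonzero, and congruent modulo all `l j`. -/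
def ModEquiv {ι : Type*} (l : ι → ℕ) (a b : ℕ) : Prop := (a = 0 ↔ b = 0) ∧ ∀ j, a ≡ b [MOD l j]

namespace ModEquiv

variable {ι : Type*} {l : ι → ℕ}

theorem refl (a : ℕ) : ModEquiv l a a := ⟨Iff.rfl, fun _ => rfl⟩

theorem symm {a b : ℕ} (h : ModEquiv l a b) : ModEquiv l b a := ⟨h.1.symm, fun j => (h.2 j).symm⟩

theorem add {a b c d : ℕ} (h : ModEquiv l a b) (h' : ModEquiv l c d) :
    ModEquiv l (a + c) (b + d) := by
  refine ⟨?_, fun j => (h.2 j).add (h'.2 j)⟩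
  rw [Nat.add_eq_zero_iff, Nat.add_eq_zero_iff, h.1, h'.1]

theorem sum {K : Type*} (s : Finset K) {f g : K → ℕ} (h : ∀ k ∈ s, ModEquiv l (f k) (g k)) :
    ModEquiv l (∑ k ∈ s, f k) (∑ k ∈ s, g k) := by
  classical
  induction s using Finset.induction_on with
  | empty => exact refl _
  | insert a s ha ih =>
    rw [Finset.sum_insert ha, Finset.sum_insert ha]
    exact (h a (Finset.mem_insert_self a s)).add
      (ih fun k hk => h k (Finset.mem_insert_of_mem hk))

end ModEquiv

open scoped Classical in
theorem ncard_setOf_comp_eq_sum {V K : Type*} [Finite V] [Fintype K] (key : V → K)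
    (Q : K → Prop) :
    {z | Q (key z)}.ncard = ∑ k ∈ Finset.univ.filter Q, {z | key z = k}.ncard := by
  have := Fintype.ofFinite V
  rw [Set.ncard_eq_toFinset_card', Finset.card_eq_sum_card_fiberwise (f := key)
    (t := Finset.univ.filter Q) (fun z hz => by simpa using hz)]
  refine Finset.sum_congr rfl fun k hk => ?_
  rw [Set.ncard_eq_toFinset_card']
  congr 1
  ext z
  have hk := (Finset.mem_filter.1 hk).2
  simp only [Finset.mem_filter, Set.mem_toFinset, Set.mem_ofPred_eq]
  exact ⟨And.right, fun h => ⟨h ▸ hk, h⟩⟩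

/-- Both sets are disjoint unions of fibres over the same keys, and the equivalence is additive. -/
theorem ModEquiv.ncard {ι : Type*} {l : ι → ℕ} {V V' K : Type*} [Finite V] [Finite V'] [Finite K]
    {key : V → K} {key' : V' → K}
    (h : ∀ k, ModEquiv l {z | key' z = k}.ncard {z | key z = k}.ncard) (Q : K → Prop) :
    ModEquiv l {z | Q (key' z)}.ncard {z | Q (key z)}.ncard := by
  have := Fintype.ofFinite K
  rw [ncard_setOf_comp_eq_sum, ncard_setOf_comp_eq_sum]
  exact ModEquiv.sum _ fun k _ => h k

theorem ncard_subtype {V : Type*} {p : V → Prop} {s : Set V} (hs : ∀ z ∈ s, p z) :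
    {z : {z // p z} | z.1 ∈ s}.ncard = s.ncard := by
  rw [← Set.ncard_image_of_injective _ Subtype.val_injective]
  congr 1
  ext z
  simp only [Set.mem_image, Set.mem_ofPred_eq, Subtype.exists, exists_and_right, exists_eq_right]
  exact ⟨fun ⟨_, h⟩ => h, fun h => ⟨hs z h, h⟩⟩

/-! ### Types of nodes -/

namespace TreeStructure

variable {P : Type*}

instance (M : TreeStructure P) : Finite M.V := M.finite

open scoped Classical in
/-- The one-type of a node over the symbols of `S`. -/
noncomputable def oneType (M : TreeStructure P) (S : Set P) (a : M.V) : OneType S :=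
  fun p => decide (M.unary p.1 a)

theorem unary_iff_of_oneType_eq {M M' : TreeStructure P} {S : Set P} {a : M.V} {a' : M'.V}
    (h : M'.oneType S a' = M.oneType S a) {p : P} (hp : p ∈ S) : M'.unary p a' ↔ M.unary p a := by
  simpa [oneType] using congrFun h ⟨p, hp⟩

/-- The position of a node relative to `a`, together with its one-type. -/
noncomputable def key (M : TreeStructure P) (S : Set P) (a b : M.V) : OrderFormula × OneType S :=
  (M.tree.pos a b, M.oneType S b)

/-- The class of a node relative to the forest of `u`, together with its one-type. -/
noncomputable def clsKey (M : TreeStructure P) (S : Set P) (u z : M.V) :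
    OrderFormula × OneType S :=
  (M.tree.cls u z, M.oneType S z)

/-- The labelled tree obtained by replacing the forest of `u` by the forest of `v`. -/
noncomputable def graft (M : TreeStructure P) (u v : M.V) (huv : M.tree.InForest u v)
    (hu : u ≠ M.tree.root) : TreeStructure P where
  V := M.tree.Remaining u v
  finite := inferInstance
  tree := M.tree.graft u v huv hu
  unary p z := M.unary p z.1

/-- The core of the surgery. The nodes on the same side of the boundary as `w` keep their positions
and contribute a common set `A`; those on the other side contribute according to their class alone,
relative to `u` in one tree and to `v` in the other. -/
theorem graft_ncard_key {ι : Type*} {l : ι → ℕ} {M : TreeStructure P} {S : Set P} [Finite S]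
    {u v : M.V} (huv : M.tree.InForest u v) (hu : u ≠ M.tree.root)
    (h : ∀ k, ModEquiv l {z | M.clsKey S u z = k}.ncard {z | M.clsKey S v z = k}.ncard)
    (w : M.tree.Remaining u v) (k : OrderFormula × OneType S) :
    ModEquiv l {z : M.tree.Remaining u v | ((M.tree.graft u v huv hu).pos w z, M.oneType S z.1) = k}.ncard
      {z | M.key S w.1 z = k}.ncard := by
  have hd : ∀ {A B : Set M.V} (X : Set M.V), (∀ z ∈ A, z ∈ X) → (∀ z ∈ B, z ∉ X) →
      (A ∪ B).ncard = A.ncard + B.ncard := fun X hA hB => Set.ncard_union_eq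
    (Set.disjoint_left.2 fun z hz hz' => hB z hz' (hA z hz)) (Set.toFinite _) (Set.toFinite _)
  rcases em (M.tree.InForest u w.1) with hw0 | hw0
  · have hw : M.tree.InForest v w.1 := w.2.resolve_left (not_not.2 hw0)
    let A : Set M.V := {z | M.tree.InForest v z ∧ M.key S w.1 z = k}
    -- `w` is inside: the class of an outer node is its position seen from the forest's first root,
    -- so it is converted, extended to `w`, and converted back.
    let Q : OrderFormula × OneType S → Prop := fun c => ¬ c.1.inner ∧
      ((c.1.conv.extend (M.tree.cls v w.1)).conv, c.2) = k
    have h1 : {z : M.tree.Remaining u v | ((M.tree.graft u v huv hu).pos w z, M.oneType S z.1) = k} =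
        {z | z.1 ∈ A ∪ {z | Q (M.clsKey S u z)}} := by
      ext z
      simp only [A, Q, Set.mem_ofPred_eq, Set.mem_union, key, clsKey, OrderedTree.cls_inner_iff]
      rcases em (M.tree.InForest u z.1) with hzu | hzu
      · have hzv : M.tree.InForest v z.1 := z.2.resolve_left (not_not.2 hzu)
        simp [hzu, hzv, OrderedTree.graft_pos_inner hw hzv]
      · have hzv : ¬ M.tree.InForest v z.1 := fun h => hzu (huv.trans h)
        rw [OrderedTree.pos_conv, OrderedTree.graft_pos_crossing hzu hw,
          OrderedTree.cls_of_not_inForest hzu, ← OrderedTree.pos_conv]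
        simp [hzu, hzv]
    have h2 : {z | M.key S w.1 z = k} = A ∪ {z | Q (M.clsKey S v z)} := by
      ext z
      simp only [A, Q, Set.mem_ofPred_eq, Set.mem_union, key, clsKey, OrderedTree.cls_inner_iff]
      rcases em (M.tree.InForest v z) with hz | hz
      · simp [hz]
      · rw [OrderedTree.pos_conv, OrderedTree.pos_crossing hz hw,
          OrderedTree.cls_of_not_inForest hz, ← OrderedTree.pos_conv]
        simp [hz]
    rw [h1, h2, ncard_subtype, hd {z | M.tree.InForest v z} (fun z hz => hz.1),
      hd {z | M.tree.InForest v z} (fun z hz => hz.1)]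
    · exact (ModEquiv.refl _).add (ModEquiv.ncard h Q)
    · exact fun z hz hz' => hz.1 (OrderedTree.cls_inner_iff.2 hz')
    · exact fun z hz hz' => hz.1 (OrderedTree.cls_inner_iff.2 (huv.trans hz'))
    · rintro z (hz | hz)
      · exact Or.inr hz.1
      · exact Or.inl fun hz' => hz.1 (OrderedTree.cls_inner_iff.2 hz')
  · let A : Set M.V := {z | ¬ M.tree.InForest u z ∧ M.key S w.1 z = k}
    let Q : OrderFormula × OneType S → Prop := fun c => c.1.inner ∧
      ((M.tree.pos w.1 u).extend c.1, c.2) = k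
    have h1 : {z : M.tree.Remaining u v | ((M.tree.graft u v huv hu).pos w z, M.oneType S z.1) = k} =
        {z | z.1 ∈ A ∪ {z | Q (M.clsKey S v z)}} := by
      ext z
      simp only [A, Q, Set.mem_ofPred_eq, Set.mem_union, key, clsKey, OrderedTree.cls_inner_iff]
      rcases em (M.tree.InForest u z.1) with hzu | hzu
      · have hzv : M.tree.InForest v z.1 := z.2.resolve_left (not_not.2 hzu)
        simp [hzu, hzv, OrderedTree.graft_pos_crossing hw0 hzv]
      · have hzv : ¬ M.tree.InForest v z.1 := fun h => hzu (huv.trans h)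
        simp [hzu, hzv, OrderedTree.graft_pos_outer hw0 hzu]
    have h2 : {z | M.key S w.1 z = k} = A ∪ {z | Q (M.clsKey S u z)} := by
      ext z
      simp only [A, Q, Set.mem_ofPred_eq, Set.mem_union, key, clsKey, OrderedTree.cls_inner_iff]
      rcases em (M.tree.InForest u z) with hz | hz
      · simp [hz, OrderedTree.pos_crossing hw0 hz]
      · simp [hz]
    rw [h1, h2, ncard_subtype, hd {z | ¬ M.tree.InForest u z} (fun z hz => hz.1),
      hd {z | ¬ M.tree.InForest u z} (fun z hz => hz.1)]
    · exact (ModEquiv.refl _).add (ModEquiv.ncard h Q).symm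
    · exact fun z hz hz' => hz' (OrderedTree.cls_inner_iff.1 hz.1)
    · exact fun z hz hz' => hz' (huv.trans (OrderedTree.cls_inner_iff.1 hz.1))
    · rintro z (hz | hz)
      · exact Or.inl hz.1
      · exact Or.inr (OrderedTree.cls_inner_iff.1 hz.1)

end TreeStructure

/-! ### Semantics of formulas in normal form -/

/-- The assignment of `a` to `x` and `b` to `y`. -/
def assign {V : Type*} (a b : V) : Var → V
  | .x => a
  | .y => b

theorem update_update_eq_assign {V : Type*} (e : Var → V) (a b : V) :
    Function.update (Function.update e .x a) .y b = assign a b := by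
  funext v
  cases v <;> simp [assign]

namespace Formula

variable {P : Type*} {M M' : TreeStructure P} {S : Set P}

theorem realize_congr {ψ : Formula P} (hψ : ψ.QuantifierFree) (hS : ψ.symbols ⊆ S)
    {e : Var → M.V} {e' : Var → M'.V} (h1 : ∀ v, M'.oneType S (e' v) = M.oneType S (e v))
    (h2 : ∀ v w, M'.tree.pos (e' v) (e' w) = M.tree.pos (e v) (e w)) :
    ψ.Realize M' e' ↔ ψ.Realize M e := by
  induction ψ with
  | unary p v => exact TreeStructure.unary_iff_of_oneType_eq (h1 v) (hS rfl)
  | nav r v w => exact OrderedTree.navRel_congr (h2 v w) r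
  | equal v w =>
    change e' v = e' w ↔ e v = e w
    rw [← OrderedTree.pos_eq_same_iff (T := M'.tree), h2, OrderedTree.pos_eq_same_iff]
  | neg φ ih => exact not_congr (ih hψ hS)
  | and φ ψ ih ih' =>
    exact and_congr (ih hψ.1 (Set.subset_union_left.trans hS))
      (ih' hψ.2 (Set.subset_union_right.trans hS))
  | or φ ψ ih ih' =>
    exact or_congr (ih hψ.1 (Set.subset_union_left.trans hS))
      (ih' hψ.2 (Set.subset_union_right.trans hS))
  | imp φ ψ ih ih' =>
    exact imp_congr (ih hψ.1 (Set.subset_union_left.trans hS))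
      (ih' hψ.2 (Set.subset_union_right.trans hS))
  | all => exact hψ.elim
  | ex => exact hψ.elim
  | exMod => exact hψ.elim

theorem realize_assign_congr {ψ : Formula P} (hψ : ψ.QuantifierFree) (hS : ψ.symbols ⊆ S)
    {a b : M.V} {a' b' : M'.V} (ha : M'.oneType S a' = M.oneType S a)
    (h : M'.key S a' b' = M.key S a b) :
    ψ.Realize M' (assign a' b') ↔ ψ.Realize M (assign a b) := by
  obtain ⟨hp, hb⟩ := Prod.ext_iff.1 h
  simp only [TreeStructure.key] at hp hb
  refine realize_congr hψ hS ?_ ?_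
  · rintro (_ | _)
    · exact ha
    · exact hb
  · rintro (_ | _) (_ | _)
    · exact (OrderedTree.pos_eq_same_iff.2 rfl).trans (OrderedTree.pos_eq_same_iff.2 rfl).symm
    · exact hp
    · simp only [assign]
      rw [OrderedTree.pos_conv, hp, ← OrderedTree.pos_conv]
    · exact (OrderedTree.pos_eq_same_iff.2 rfl).trans (OrderedTree.pos_eq_same_iff.2 rfl).symm

/-- The truth of `ψ` at a pair depends only on the one-type of the first node and the key of the
second, so the witnesses form a union of key classes. -/
theorem modEquiv_ncard_realize [Finite S] {ι : Type*} {l : ι → ℕ} {ψ : Formula P}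
    (hψ : ψ.QuantifierFree) (hS : ψ.symbols ⊆ S) {a : M.V} {a' : M'.V}
    (ha : M'.oneType S a' = M.oneType S a)
    (h : ∀ k, ModEquiv l {z | M'.key S a' z = k}.ncard {z | M.key S a z = k}.ncard) :
    ModEquiv l {z | ψ.Realize M' (assign a' z)}.ncard {z | ψ.Realize M (assign a z)}.ncard := by
  let Q : OrderFormula × OneType S → Prop := fun k =>
    ∃ b, M.key S a b = k ∧ ψ.Realize M (assign a b)
  have h1 : {z | ψ.Realize M (assign a z)} = {z | Q (M.key S a z)} := by
    ext z
    exact ⟨fun hz => ⟨z, rfl, hz⟩,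
      fun ⟨b, hb, hb'⟩ => (realize_assign_congr hψ hS rfl hb.symm).2 hb'⟩
  have h2 : {z | ψ.Realize M' (assign a' z)} = {z | Q (M'.key S a' z)} := by
    ext z
    refine ⟨fun hz => ?_, fun ⟨b, hb, hb'⟩ => (realize_assign_congr hψ hS ha hb.symm).2 hb'⟩
    have hne : {b | M.key S a b = M'.key S a' z}.Nonempty := by
      rw [Set.nonempty_iff_ne_empty, Ne, ← Set.ncard_eq_zero, ← (h _).1,
        Set.ncard_eq_zero, ← Ne, ← Set.nonempty_iff_ne_empty]
      exact ⟨z, rfl⟩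
    obtain ⟨b, hb⟩ := hne
    exact ⟨b, hb, (realize_assign_congr hψ hS ha hb.symm).1 hz⟩
  rw [h1, h2]
  exact ModEquiv.ncard h Q

theorem realize_foldl_and (L : List (Formula P)) (ψ : Formula P) (e : Var → M.V) :
    (L.foldl Formula.and ψ).Realize M e ↔ ψ.Realize M e ∧ ∀ χ ∈ L, χ.Realize M e := by
  induction L generalizing ψ with
  | nil => simp
  | cons a L ih =>
    rw [List.foldl_cons, ih, List.forall_mem_cons, ← and_assoc]
    rfl

theorem symbols_foldl_and (L : List (Formula P)) (ψ : Formula P) :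
    ψ.symbols ⊆ (L.foldl Formula.and ψ).symbols ∧
      ∀ χ ∈ L, χ.symbols ⊆ (L.foldl Formula.and ψ).symbols := by
  induction L generalizing ψ with
  | nil => simp
  | cons a L ih =>
    obtain ⟨h1, h2⟩ := ih (ψ.and a)
    rw [List.foldl_cons, List.forall_mem_cons]
    exact ⟨Set.subset_union_left.trans h1, Set.subset_union_right.trans h1, h2⟩

theorem size_foldl_and (L : List (Formula P)) (ψ : Formula P) :
    ψ.size + (L.map size).sum ≤ (L.foldl Formula.and ψ).size := by
  induction L generalizing ψ with
  | nil => simp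
  | cons a L ih =>
    rw [List.foldl_cons, List.map_cons, List.sum_cons]
    have := ih (ψ.and a)
    simp only [size] at this
    omega

theorem finite_symbols (ψ : Formula P) : ψ.symbols.Finite := by
  induction ψ with
  | unary => exact Set.finite_singleton _
  | nav => exact Set.finite_empty
  | equal => exact Set.finite_empty
  | and _ _ h h' => exact h.union h'
  | or _ _ h h' => exact h.union h'
  | imp _ _ h h' => exact h.union h'
  | neg _ h => exact h
  | all _ _ h => exact h
  | ex _ _ h => exact h
  | exMod _ _ _ _ _ h => exact h

theorem ncard_symbols_le_size (ψ : Formula P) : ψ.symbols.ncard ≤ ψ.size := by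
  induction ψ with
  | unary => simp [symbols, size]
  | nav => simp [symbols]
  | equal => simp [symbols]
  | and φ ψ h h' =>
    have := Set.ncard_union_le φ.symbols ψ.symbols
    simp only [symbols, size]; omega
  | or φ ψ h h' =>
    have := Set.ncard_union_le φ.symbols ψ.symbols
    simp only [symbols, size]; omega
  | imp φ ψ h h' =>
    have := Set.ncard_union_le φ.symbols ψ.symbols
    simp only [symbols, size]; omega
  | neg _ h => simp only [symbols, size]; omega
  | all _ _ h => simp only [symbols, size]; omega
  | ex _ _ h => simp only [symbols, size]; omega
  | exMod _ _ _ _ _ h => simp only [symbols, size]; omega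

end Formula

namespace NormalForm

variable {P : Type*} (φ : NormalForm P)

theorem models_iff (M : TreeStructure P) :
    M.Models φ.toFormula ↔
      (∀ a b, φ.chi.Realize M (assign a b)) ∧
      (∀ i a, ∃ b, (φ.chis i).Realize M (assign a b)) ∧
      (∀ j a, (φ.cmp j).holds ({b | (φ.psi j).Realize M (assign a b)}.ncard % φ.l j) (φ.k j)) := by
  simp only [TreeStructure.Models, toFormula, Formula.realize_foldl_and, List.mem_append,
    List.mem_ofFn, or_imp, forall_and, forall_exists_index, forall_apply_eq_imp_iff,
    Formula.Realize, update_update_eq_assign]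
  have hn : Nonempty (Var → M.V) := ⟨fun _ => M.tree.root⟩
  simp only [forall_const]

theorem symbols_subset : φ.chi.symbols ⊆ φ.toFormula.symbols ∧
    (∀ i, (φ.chis i).symbols ⊆ φ.toFormula.symbols) ∧
    ∀ j, (φ.psi j).symbols ⊆ φ.toFormula.symbols := by
  have h := Formula.symbols_foldl_and
    (List.ofFn (fun i => Formula.all .x (.ex .y (φ.chis i))) ++
      List.ofFn (fun j => Formula.all .x (.exMod (φ.cmp j) (φ.l j) (φ.k j) .y (φ.psi j))))
    (.all .x (.all .y φ.chi))
  refine ⟨h.1, fun i => h.2 (.all .x (.ex .y (φ.chis i))) (List.mem_append_left _ (List.mem_ofFn.2 ⟨i, rfl⟩)),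
    fun j => h.2 (.all .x (.exMod (φ.cmp j) (φ.l j) (φ.k j) .y (φ.psi j)))
      (List.mem_append_right _ (List.mem_ofFn.2 ⟨j, rfl⟩))⟩

theorem models_of_modEquiv {M M' : TreeStructure P} {S : Set P} [Finite S]
    (hS : φ.toFormula.symbols ⊆ S) (hM : M.Models φ.toFormula) (g : M'.V → M.V)
    (hg : ∀ a, M'.oneType S a = M.oneType S (g a))
    (h : ∀ a k, ModEquiv φ.l {z | M'.key S a z = k}.ncard {z | M.key S (g a) z = k}.ncard) :
    M'.Models φ.toFormula := by
  rw [models_iff] at hM ⊢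
  obtain ⟨h1, h2, h3⟩ := hM
  obtain ⟨s1, s2, s3⟩ := φ.symbols_subset
  have key : ∀ {ψ : Formula P}, ψ.QuantifierFree → ψ.symbols ⊆ φ.toFormula.symbols → ∀ a,
      ModEquiv φ.l {z | ψ.Realize M' (assign a z)}.ncard
        {z | ψ.Realize M (assign (g a) z)}.ncard := fun hψ hs a =>
    Formula.modEquiv_ncard_realize hψ (hs.trans hS) (hg a) (h a)
  refine ⟨fun a b => ?_, fun i a => ?_, fun j a => ?_⟩
  · by_contra hab
    -- The universal conjunct says that the number of counterexamples is zero.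
    have := (key (ψ := φ.chi.neg) φ.chi_qf s1 a).1
    rw [Set.ncard_eq_zero, Set.ncard_eq_zero] at this
    have he := this.2 (Set.eq_empty_of_forall_notMem fun z hz => hz (h1 (g a) z))
    exact he.subset (show b ∈ _ from hab)
  · have := (key (φ.chis_qf i) (s2 i) a).1
    rw [Set.ncard_eq_zero, Set.ncard_eq_zero] at this
    change Set.Nonempty {b | (φ.chis i).Realize M' (assign a b)}
    rw [Set.nonempty_iff_ne_empty, Ne, this, ← Ne, ← Set.nonempty_iff_ne_empty]
    exact h2 i (g a)
  · have := (key (φ.psi_qf j) (s3 j) a).2 j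
    rw [show _ % _ = _ % _ from this]
    exact h3 j (g a)

end NormalForm

end FO2Mod

namespace FO2Mod

/-! ### The small model property -/

namespace NormalForm

variable {P : Type*} (φ : NormalForm P)

/-- The functions assigning to every order formula and one-type an element of
`{0, 1} × ℤ_{l₁} × ⋯ × ℤ_{lₘ}`. -/
abbrev State : Type _ :=
  OrderFormula × OneType φ.toFormula.symbols → Bool × ∀ j, ZMod (φ.l j)

theorem l_pos (j : Fin φ.m) : 0 < φ.l j := (φ.k j).pos

instance : Finite φ.toFormula.symbols := Formula.finite_symbols _

instance (j : Fin φ.m) : NeZero (φ.l j) := ⟨(φ.l_pos j).ne'⟩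

instance : Finite φ.State :=
  have : ∀ j, Finite (ZMod (φ.l j)) := fun _ => inferInstance
  inferInstance

theorem card_state : Nat.card φ.State = φ.f := by
  have := Fintype.ofFinite (OneType φ.toFormula.symbols)
  rw [State, Nat.card_fun, Nat.card_prod, Nat.card_pi, Nat.card_prod, f]
  simp

variable {φ}

/-- The numbers of nodes of each class relative to the forest of `u` and each one-type, up to zero
and the moduli of `φ`. -/
noncomputable def state (φ : NormalForm P) (M : TreeStructure P) (u : M.V) : φ.State := fun k =>
  (decide ({z | M.clsKey φ.toFormula.symbols u z = k}.ncard = 0),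
    fun _ => ({z | M.clsKey φ.toFormula.symbols u z = k}.ncard : ℕ))

theorem modEquiv_of_state_eq {M : TreeStructure P} {u v : M.V}
    (h : φ.state M u = φ.state M v) (k : OrderFormula × OneType φ.toFormula.symbols) :
    ModEquiv φ.l {z | M.clsKey φ.toFormula.symbols u z = k}.ncard
      {z | M.clsKey φ.toFormula.symbols v z = k}.ncard := by
  obtain ⟨h1, h2⟩ := Prod.ext_iff.1 (congrFun h k)
  exact ⟨by simpa [state] using h1, fun j => (ZMod.natCast_eq_natCast_iff _ _ _).1 (congrFun h2 j)⟩

/-- A node with the same state as another node in whose forest it lies allows to shrink the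
model. -/
theorem exists_smaller_model {M : TreeStructure P} (hM : M.Models φ.toFormula) {u v : M.V}
    (huv : M.tree.InForest u v) (hne : u ≠ v) (h : φ.state M u = φ.state M v) :
    ∃ M' : TreeStructure P, M'.Models φ.toFormula ∧ Nat.card M'.V < Nat.card M.V := by
  have hk := modEquiv_of_state_eq h
  have hu : u ≠ M.tree.root := by
    rintro rfl
    obtain ⟨p, hp⟩ := OrderedTree.exists_parent hne.symm
    -- The state sees the parent through class `up`: the root has no node of this class, while `v`
    -- has `p`. Hence `u` is not the root.
    have h0 := (hk (.up, M.oneType _ p)).1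
    rw [Set.ncard_eq_zero, Set.ncard_eq_zero] at h0
    have hempty := h0.1 (Set.eq_empty_of_forall_notMem fun z hz => by
      have hz := OrderedTree.cls_eq_up_iff.1 (Prod.ext_iff.1 hz).1
      rw [OrderedTree.Child, (M.tree.parent_eq_none _).2 rfl] at hz
      cases hz)
    exact hempty.subset (show p ∈ _ from Prod.ext (OrderedTree.cls_eq_up_iff.2 hp) rfl)
  refine ⟨M.graft u v huv hu, φ.models_of_modEquiv subset_rfl hM Subtype.val (fun _ => rfl)
    (TreeStructure.graft_ncard_key huv hu hk), ?_⟩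
  -- This makes `u` disappear in the replacement, so that the new model is strictly smaller.
  have hv : ¬ M.tree.InForest v u := by
    intro hvu
    obtain ⟨t, ht, htv⟩ := huv
    obtain ⟨s, hs, hsu⟩ := hvu
    rcases Relation.reflTransGen_iff_eq_or_transGen.1 htv with rfl | htv
    · rcases ht with rfl | ht
      · exact hne rfl
      · exact OrderedTree.not_inForest_of_sibLT ht ⟨s, hs, hsu⟩
    · have htu := (OrderedTree.desc_congr_right hs.parent_eq.symm htv).trans_left hsu
      exact OrderedTree.desc_irrefl t (OrderedTree.desc_congr_right ht.parent_eq.symm htu)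
  exact Finite.card_subtype_lt (x := u) fun h =>
    h.elim (fun h => h (OrderedTree.inForest_refl u)) hv

/-- Later nodes of a downward path lie in the forests of earlier ones, so the states along the path
are distinct. -/
theorem length_le_of_isChain {M : TreeStructure P}
    (hM : ∀ u v : M.V, M.tree.InForest u v → φ.state M u = φ.state M v → u = v)
    (p : List M.V) (hp : p.IsChain M.tree.Child) : p.length ≤ φ.f := by
  have hd : p.Pairwise M.tree.Desc := (hp.imp fun _ _ h => .single h).pairwise
  rw [← card_state, ← Nat.card_fin p.length]
  refine Nat.card_le_card_of_injective (fun i => φ.state M (p.get i)) fun i j hij => ?_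
  have key : ∀ i j : Fin p.length, i < j → φ.state M (p.get i) ≠ φ.state M (p.get j) := by
    intro i j hij h
    have hd' := List.pairwise_iff_get.1 hd i j hij
    have := hM _ _ ((OrderedTree.inForest_refl _).reflTransGen hd'.to_reflTransGen) h
    exact OrderedTree.desc_irrefl _ (this ▸ hd')
  rcases lt_trichotomy i j with h | h | h
  · exact absurd hij (key i j h)
  · exact h
  · exact absurd hij.symm (key j i h)

/-- Of two distinct children, the later one lies in the forest of the earlier one, so `φ.state M` is
injective on the children. -/
theorem degree_le {M : TreeStructure P}
    (hM : ∀ u v : M.V, M.tree.InForest u v → φ.state M u = φ.state M v → u = v) (v : M.V) :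
    M.tree.degree v ≤ φ.f := by
  rw [← card_state, OrderedTree.degree, ← Set.ncard_univ]
  refine Set.ncard_le_ncard_of_injOn (φ.state M) (fun _ _ => Set.mem_univ _) ?_ (Set.toFinite _)
  intro a ha b hb hab
  rcases OrderedTree.sibLT_trichotomy (T := M.tree) (a := a) (b := b)
    (Eq.trans ha (Eq.symm hb)) with h | h | h
  · exact hM a b ((OrderedTree.inForest_refl a).sibLT h) hab
  · exact h
  · exact (hM b a ((OrderedTree.inForest_refl b).sibLT h) hab.symm).symm

theorem exists_small_model (h : ∃ M : TreeStructure P, M.Models φ.toFormula) :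
    ∃ M : TreeStructure P, M.Models φ.toFormula ∧
      (∀ p : List M.V, p.IsChain M.tree.Child → p.length ≤ φ.f) ∧
      (∀ v : M.V, M.tree.degree v ≤ φ.f) := by
  obtain ⟨M, hM, hmin⟩ := (measure fun M : TreeStructure P => Nat.card M.V).wf.has_min
    {M | M.Models φ.toFormula} h
  have key : ∀ u v : M.V, M.tree.InForest u v → φ.state M u = φ.state M v → u = v := by
    intro u v huv hs
    by_contra hne
    obtain ⟨M', hM', hlt⟩ := exists_smaller_model hM huv hne hs
    exact hmin M' hM' hlt
  exact ⟨M, hM, length_le_of_isChain key, degree_le key⟩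

/-! ### The size of the bound -/

theorem prod_le_two_pow_sum_size {m : ℕ} (l : Fin m → ℕ) :
    ∏ j, l j ≤ 2 ^ ∑ j, Nat.size (l j) := by
  rw [← Finset.prod_pow_eq_pow_sum]
  exact Finset.prod_le_prod' fun j _ => (Nat.lt_size_self _).le

theorem sum_size_lt (φ : NormalForm P) : 1 + ∑ j, Nat.size (φ.l j) ≤ φ.toFormula.size := by
  refine le_trans ?_ (Formula.size_foldl_and _ _)
  rw [List.map_append, List.sum_append, List.map_ofFn, List.map_ofFn, List.sum_ofFn, List.sum_ofFn]
  have : ∑ j, Nat.size (φ.l j) ≤ ∑ j, (Formula.size ∘ fun j => Formula.all .x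
      (.exMod (φ.cmp j) (φ.l j) (φ.k j) .y (φ.psi j))) j := by
    refine Finset.sum_le_sum fun j _ => ?_
    simp only [Function.comp, Formula.size]
    omega
  simp only [Formula.size]
  omega

theorem f_le (φ : NormalForm P) : φ.f ≤ 2 ^ 2 ^ (6 * φ.toFormula.size) := by
  have h1 := φ.sum_size_lt
  have h2 := φ.toFormula.ncard_symbols_le_size
  generalize hs : φ.toFormula.size = s at *
  have hc : Nat.card (OneType φ.toFormula.symbols) = 2 ^ φ.toFormula.symbols.ncard := by
    rw [OneType, Nat.card_fun]
    simp
  have hΘ : Fintype.card OrderFormula = 10 := rfl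
  rw [f, hc, hΘ]
  have hb : 2 * ∏ j, φ.l j ≤ 2 ^ s := by
    calc 2 * ∏ j, φ.l j ≤ 2 * 2 ^ ∑ j, Nat.size (φ.l j) :=
          Nat.mul_le_mul_left _ (prod_le_two_pow_sum_size _)
      _ = 2 ^ (1 + ∑ j, Nat.size (φ.l j)) := by rw [pow_add, pow_one]
      _ ≤ 2 ^ s := Nat.pow_le_pow_right two_pos h1
  -- With `s ≤ 2 ^ s` and `10 ≤ 2 ^ 4` the exponent is at most `2 * s + 4`, which is at most `6 * s`
  -- because `s ≥ 1`; this is the origin of the constant 6.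
  have he : s * (10 * 2 ^ φ.toFormula.symbols.ncard) ≤ 2 ^ (6 * s) := by
    calc s * (10 * 2 ^ φ.toFormula.symbols.ncard) ≤ 2 ^ s * (2 ^ 4 * 2 ^ s) :=
          Nat.mul_le_mul Nat.lt_two_pow_self.le
            (Nat.mul_le_mul (by norm_num) (Nat.pow_le_pow_right two_pos h2))
      _ = 2 ^ (s + (4 + s)) := by rw [pow_add, pow_add]
      _ ≤ 2 ^ (6 * s) := Nat.pow_le_pow_right two_pos (by omega)
  calc (2 * ∏ j, φ.l j) ^ (10 * 2 ^ φ.toFormula.symbols.ncard)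
      ≤ (2 ^ s) ^ (10 * 2 ^ φ.toFormula.symbols.ncard) := Nat.pow_le_pow_left hb _
    _ = 2 ^ (s * (10 * 2 ^ φ.toFormula.symbols.ncard)) := (pow_mul _ _ _).symm
    _ ≤ 2 ^ 2 ^ (6 * s) := Nat.pow_le_pow_right two_pos he

end NormalForm

end FO2Mod

theorem mainTheorem2 :
    -- `f(φ)` is at most doubly exponential in the length of `φ`
    (∃ c : ℕ, ∀ (P : Type*) (φ : FO2Mod.NormalForm P),
      φ.f ≤ 2 ^ 2 ^ (c * φ.toFormula.size)) ∧
    -- the small model property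
    (∀ (P : Type*) (φ : FO2Mod.NormalForm P),
      (∃ M : FO2Mod.TreeStructure P, M.Models φ.toFormula) →
      ∃ M : FO2Mod.TreeStructure P, M.Models φ.toFormula ∧
        (∀ p : List M.V, p.IsChain M.tree.Child → p.length ≤ φ.f) ∧
        (∀ v : M.V, M.tree.degree v ≤ φ.f)) :=
  ⟨⟨6, fun _ φ => φ.f_le⟩, fun _ _ h => FO2Mod.NormalForm.exists_small_model h⟩
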